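/- Let $K$ be a field of characteristic $0$. Let $\mathcal{LT}$ be the free nonsymmetric operad over $K$ with one ternary operation $t=({*}{*}{*})$ of even homological degree (so there are no Koszul signs): $\mathcal{LT}(n)$ has as basis the ternary trees with $n$ leaves, with partial compositions $\circ_i$ given by grafting at the $i$-th leaf. Let $\alpha = t\circ_1 t+t\circ_2 t+t\circ_3 t$, let $\langle\alpha\rangle$ be the operad ideal generated by $\alpha$, and let $\mathcal{TPA}=\mathcal{LT}/\langle\alpha\rangle$ be the ternary partially associative operad. Compare trees of equal arity by the lexicographic order on their path sequences (the sequence of distances from the root to the leaves, read from left to right). For trees $p,q$ write $p\mid q$ if $q$ can be obtained from $p$ by a sequence of partial compositions with trees (on either side). A finite set $G$ of nonzero homogeneous elements generating an operad ideal $I$ is a Gröbner basis of $I$ if the leading monomial of every nonzero homogeneous element of $I$ is divisible by the leading monomial of some element of $G$. Then: 1. $\dim\mathcal{TPA}(1)=\dim\mathcal{TPA}(3)=1$, $\dim\mathcal{TPA}(5)=2$, $\dim\mathcal{TPA}(7)=4$. 2. The following five elements form a Gröbner basis of $\langle\alpha\rangle$: $$\alpha,\qquad \beta = t\circ_2(t\circ_3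 t)+t\circ_3(t\circ_2 t)+t\circ_3(t\circ_3 t),$$ $$\eta=(t\circ_2 t)\circ_5(t\circ_2 t)+(t\circ_2 t)\circ_5(t\circ_3 t),\qquad \theta=t\circ_3((t\circ_2 t)\circ_5 t),\qquad \nu=t\circ_3(t\circ_3(t\circ_3 t)).$$ 3. For every $k\ge 3$, $\dim\mathcal{TPA}(2k+1)=k+1$. Moreover, let $M_0$ be the one-vertex tree and $M_{\ell+1}=t\circ_2 M_\ell$, and put $$f_1=t\circ_3(t\circ_3 M_{k-2}),\quad f_2=t\circ_3M_{k-1},\quad f_i=(t\circ_3(t\circ_3M_{k-i}))\circ_2M_{i-2}\ (3\le i\le k),\quad f_{k+1}=M_k.$$ Then the classes of $f_1,\dots,f_{k+1}$ form a basis of $\mathcal{TPA}(2k+1)$, and $f_1,\dots,f_{k+1}$ are exactly the trees with $2k+1$ leaves that are not divisible by the leading monomial of any of $\alpha,\beta,\eta,\theta,\nu$. -/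

import Mathlib

noncomputable section

/-- Ternary trees: rooted plane trees in which every node has no children (a leaf)
or three children (an internal node). -/
inductive TernaryTree : Type
  | leaf : TernaryTree
  | node (l m r : TernaryTree) : TernaryTree

namespace TernaryTree

/-- The weight: the number of internal nodes. -/
def weight : TernaryTree → ℕ
  | leaf => 0
  | node l m r => l.weight + m.weight + r.weight + 1

/-- The arity: the number of leaves. -/
def arity : TernaryTree → ℕ
  | leaf => 1
  | node l m r => l.arity + m.arity + r.arity

/-- The partial composition `p ∘ᵢ q`: identify the `i`-th leaf of `p` (leaves are numbered
`1, …, p.arity` from left to right) with the root of `q`. Only used for `1 ≤ i ≤ p.arity`. -/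
def graft : TernaryTree → ℕ → TernaryTree → TernaryTree
  | leaf, i, q => if i = 1 then q else leaf
  | node l m r, i, q =>
    if i ≤ l.arity then node (l.graft i q) m r
    else if i ≤ l.arity + m.arity then node l (m.graft (i - l.arity) q) r
    else node l m (r.graft (i - (l.arity + m.arity)) q)

/-- The basic tree, of weight 1. -/
def t : TernaryTree := node leaf leaf leaf

/-- The path sequence: the distances from the root to the leaves, from left to right. -/
def path : TernaryTree → List ℕ
  | leaf => [0]
  | node l m r => (l.path ++ m.path ++ r.path).map (· + 1)

/-- Path-lex order: lexicographic comparison of path sequences.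
Only used for trees of the same arity. -/
def PathLex (p q : TernaryTree) : Prop := p.path < q.path

/-- `Divides p q`: the tree `q` is obtained from `p` by a sequence of partial compositions,
that is, `p` is a subtree of `q` in the sense of operads. -/
inductive Divides (p : TernaryTree) : TernaryTree → Prop
  | refl : Divides p p
  | graft_right {q : TernaryTree} (i : ℕ) (r : TernaryTree) (h : Divides p q)
      (hi : 1 ≤ i) (hi' : i ≤ q.arity) : Divides p (q.graft i r)
  | graft_left {q : TernaryTree} (j : ℕ) (r : TernaryTree) (h : Divides p q)
      (hj : 1 ≤ j) (hj' : j ≤ r.arity) : Divides p (r.graft j q)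

/-- `M 0` is the tree with one vertex and `M l = t ∘₂ (t ∘₂ ⋯ (t ∘₂ t) ⋯ )` with `l` copies
of `t`. -/
def M : ℕ → TernaryTree
  | 0 => leaf
  | l + 1 => t.graft 2 (M l)

/-- The trees `f₁, …, f_{k+1}` of weight `k`, where `k ≥ 3` and `1 ≤ i ≤ k + 1`. -/
def normalTree (k i : ℕ) : TernaryTree :=
  if i = 1 then t.graft 3 (t.graft 3 (M (k - 2)))
  else if i = 2 then t.graft 3 (M (k - 1))
  else if i ≤ k then (t.graft 3 (t.graft 3 (M (k - i)))).graft 2 (M (i - 2))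
  else M k

end TernaryTree

open TernaryTree

/-- The underlying vector space of the free nonsymmetric operad over `K` with one ternary
operation of even degree (no Koszul signs): its basis is the set of all ternary trees. -/
abbrev FreeTernary (K : Type*) [Field K] : Type _ := TernaryTree →₀ K

namespace FreeTernary

variable (K : Type*) [Field K]

/-- The tree monomial of a tree. -/
def mono (p : TernaryTree) : FreeTernary K := Finsupp.single p 1

/-- The homogeneous component of arity `n`, with basis the trees of arity `n`. -/
def component (n : ℕ) : Submodule K (FreeTernary K) :=
  Finsupp.supported K K {p : TernaryTree | p.arity = n}

variable {K}

/-- Partial composition, extended bilinearly from trees. -/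
def comp (f : FreeTernary K) (i : ℕ) (g : FreeTernary K) : FreeTernary K :=
  f.sum fun p a => g.sum fun q b => Finsupp.single (p.graft i q) (a * b)

/-- Operad ideals: homogeneous subspaces that are closed under partial composition, on either
side, with arbitrary elements. -/
structure IsOperadIdeal (S : Submodule K (FreeTernary K)) : Prop where
  homogeneous : ∀ f ∈ S, ∀ n : ℕ, f.filter (fun p => p.arity = n) ∈ S
  comp_right : ∀ (m n : ℕ) (f g : FreeTernary K), f ∈ S → f ∈ component K m →
    g ∈ component K n → ∀ i : ℕ, 1 ≤ i → i ≤ m → f.comp i g ∈ S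
  comp_left : ∀ (m n : ℕ) (f g : FreeTernary K), f ∈ S → f ∈ component K m →
    g ∈ component K n → ∀ j : ℕ, 1 ≤ j → j ≤ n → g.comp j f ∈ S

/-- The operad ideal generated by a set of relations. -/
def operadIdeal (G : Set (FreeTernary K)) : Submodule K (FreeTernary K) :=
  sInf {S : Submodule K (FreeTernary K) | IsOperadIdeal S ∧ G ⊆ S}

/-- `p` is the leading monomial of `f`: the greatest tree in path-lex order among the trees
that occur in `f` with a nonzero coefficient. Only used for homogeneous `f`. -/
def IsLeadingMonomial (f : FreeTernary K) (p : TernaryTree) : Prop :=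
  p ∈ f.support ∧ ∀ q ∈ f.support, q ≠ p → PathLex q p

/-- `G` is a Gröbner basis of `I` for the path-lex order: a finite set of (nonzero, homogeneous)
relations that generates `I` as an operad ideal, such that the leading monomial of every nonzero
homogeneous element of `I` is divisible by the leading monomial of an element of `G`. -/
structure IsGroebnerBasis (G : Set (FreeTernary K)) (I : Submodule K (FreeTernary K)) :
    Prop where
  finite : G.Finite
  relation : ∀ g ∈ G, g ≠ 0 ∧ ∃ n : ℕ, g ∈ component K n
  generates : operadIdeal G = I
  divides : ∀ (n : ℕ) (f : FreeTernary K), f ∈ I → f ∈ component K n → f ≠ 0 →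
    ∃ g ∈ G, ∃ p q : TernaryTree,
      IsLeadingMonomial g p ∧ IsLeadingMonomial f q ∧ Divides p q

variable (K)

/-- Partial associativity `((∗∗∗)∗∗) + (∗(∗∗∗)∗) + (∗∗(∗∗∗))`. -/
def alpha : FreeTernary K :=
  mono K (t.graft 1 t) + mono K (t.graft 2 t) + mono K (t.graft 3 t)

/-- `(∗(∗∗(∗∗∗))∗) + (∗∗(∗(∗∗∗)∗)) + (∗∗(∗∗(∗∗∗)))`. -/
def beta : FreeTernary K :=
  mono K (t.graft 2 (t.graft 3 t)) + mono K (t.graft 3 (t.graft 2 t))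
    + mono K (t.graft 3 (t.graft 3 t))

/-- `(∗(∗∗∗)(∗(∗∗∗)∗)) + (∗(∗∗∗)(∗∗(∗∗∗)))`. -/
def eta : FreeTernary K :=
  mono K ((t.graft 2 t).graft 5 (t.graft 2 t)) + mono K ((t.graft 2 t).graft 5 (t.graft 3 t))

/-- `(∗∗(∗(∗∗∗)(∗∗∗)))`. -/
def theta : FreeTernary K := mono K (t.graft 3 ((t.graft 2 t).graft 5 t))

/-- `(∗∗(∗∗(∗∗(∗∗∗))))`. -/
def nu : FreeTernary K := mono K (t.graft 3 (t.graft 3 (t.graft 3 t)))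

/-- The set of the five relations `α, β, η, θ, ν`. -/
def groebner : Set (FreeTernary K) := {alpha K, beta K, eta K, theta K, nu K}

/-- The operad ideal generated by partial associativity. -/
def tpaIdeal : Submodule K (FreeTernary K) := operadIdeal {alpha K}

end FreeTernary

/-- The (underlying vector space of the) ternary partially associative operad with an even
generator: the quotient of the free operad by the ideal generated by partial associativity. -/
abbrev TPA (K : Type*) [Field K] : Type _ := FreeTernary K ⧸ FreeTernary.tpaIdeal K

namespace TPA

variable (K : Type*) [Field K]

/-- The homogeneous component of arity `n`: the image of that of the free operad. -/
def component (n : ℕ) : Submodule K (TPA K) :=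
  (FreeTernary.component K n).map (FreeTernary.tpaIdeal K).mkQ

/-- The class of a tree monomial. -/
def mono (p : TernaryTree) : TPA K := (FreeTernary.tpaIdeal K).mkQ (FreeTernary.mono K p)

end TPA

end

/-!
The five relations `α, β, η, θ, ν` determine which trees are irreducible: those with no occurrence
of a leading monomial. Two facts about irreducible trees give everything.

*They span the quotient.* Each of `β, η, θ, ν` is an explicit rational combination of consequences
of `α` (`TPA.mono_beta`, `TPA.mono_nu`, `TPA.mono_eta`, `TPA.mono_theta`), with denominators `2`
and `3`; this is where characteristic `0` enters. Since grafting a tree on a node preserves the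
path-lexicographic order, a reducible tree is congruent to a combination of smaller trees of the
same arity (`TPA.mono_mem_lower_of_reducible`). There are finitely many trees of each arity, so
every tree is congruent to a combination of irreducible trees that are not greater than it
(`TPA.mono_mem_span_normal`).

*They are linearly independent in the quotient.* For a nonsymmetric operad, the free algebra on one
generator has the same underlying space as the operad. Accordingly, the space with the irreducible
trees as basis (here with infinite combinations allowed) carries a ternary partially associative
product, given by its structure constants
(`NormalForm.mul`, `NormalForm.mul_assoc_sum`). The multilinear identities of this
algebra form an operad ideal that contains `α` (`NormalForm.isOperadIdeal_identities`,
`NormalForm.alpha_mem_identities`), and each irreducible tree, evaluated with the generator at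
every leaf, is the corresponding basis vector (`NormalForm.eval_tree`). So the structure constants
replace the confluence check of the S-polynomials.

If the leading monomial of an element of the ideal were irreducible, it would be congruent to a
combination of smaller irreducible trees, against linear independence
(`FreeTernary.IsLeadingMonomial.reducible`); this is the Gröbner basis property. The dimensions and
the basis follow from the list of irreducible trees (`NormalForm.not_reducible_iff`,
`NormalForm.range_normalTree`).
-/

noncomputable section

open TernaryTree

/-! ### Arity and grafting -/

namespace TernaryTree

theorem arity_pos (p : TernaryTree) : 0 < p.arity := by
  induction p with
  | leaf => exact Nat.one_pos
  | node a b c => simp only [arity]; omega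

theorem arity_graft (p q : TernaryTree) {i : ℕ} (hi : i < p.arity) :
    (p.graft (i + 1) q).arity + 1 = p.arity + q.arity := by
  induction p generalizing i with
  | leaf => simp_all [arity, graft]; omega
  | node a b c iha ihb ihc =>
    simp only [arity] at hi
    rw [graft]
    split_ifs with h₁ h₂
    · have := iha (i := i) (by omega)
      simp only [arity]; omega
    · have := ihb (i := i - a.arity) (by omega)
      rw [show i + 1 - a.arity = i - a.arity + 1 by omega]
      simp only [arity]; omega
    · have := ihc (i := i - (a.arity + b.arity)) (by omega)
      rw [show i + 1 - (a.arity + b.arity) = i - (a.arity + b.arity) + 1 by omega]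
      simp only [arity]; omega

theorem M_succ (k : ℕ) : M (k + 1) = .node .leaf (M k) .leaf := by
  simp [M, t, graft, arity]

theorem arity_M (k : ℕ) : (M k).arity = 2 * k + 1 := by
  induction k with
  | zero => rfl
  | succ k ih => rw [M_succ, arity, arity, ih]; omega

/-! ### The path-lexicographic order -/

/-- The path sequence of `p`, with `d` added to all distances: the part of the path sequence of a
tree that comes from a subtree `p` at depth `d`. -/
def pathFrom : ℕ → TernaryTree → List ℕ
  | d, leaf => [d]
  | d, node a b c => pathFrom (d + 1) a ++ pathFrom (d + 1) b ++ pathFrom (d + 1) c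

theorem pathFrom_eq_map (d : ℕ) (p : TernaryTree) : pathFrom d p = p.path.map (· + d) := by
  induction p generalizing d with
  | leaf => simp [pathFrom, path]
  | node a b c iha ihb ihc =>
    simp only [pathFrom, path, iha, ihb, ihc, List.map_append, List.map_map]
    simp only [show ((· + d) ∘ (· + 1) : ℕ → ℕ) = (· + (d + 1)) from by
      funext x; simp; omega]

theorem path_eq_pathFrom (p : TernaryTree) : p.path = pathFrom 0 p := by
  simp [pathFrom_eq_map]

theorem path_node (a b c : TernaryTree) : (node a b c).path =
    pathFrom 1 a ++ (pathFrom 1 b ++ pathFrom 1 c) := by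
  simp [path_eq_pathFrom, pathFrom]

theorem length_path (p : TernaryTree) : p.path.length = p.arity := by
  induction p with
  | leaf => rfl
  | node a b c iha ihb ihc => simp [path, arity, iha, ihb, ihc]; omega

theorem exists_pathFrom_eq_cons (p : TernaryTree) :
    ∃ (k : ℕ) (L : List ℕ), ∀ d, pathFrom d p = (k + d) :: L.map (· + d) := by
  rcases h : p.path with _ | ⟨k, L⟩
  · have := length_path p
    have := p.arity_pos
    simp_all
  · exact ⟨k, L, fun d => by simp [pathFrom_eq_map, h]⟩

/-- If two trees agree in planar order up to a subtree that lies deeper in the second one, then the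
first tree is smaller. -/
theorem pathFrom_append_lt (d : ℕ) (p : TernaryTree) (X Y : List ℕ) :
    pathFrom d p ++ X < pathFrom (d + 1) p ++ Y := by
  obtain ⟨k, L, h⟩ := exists_pathFrom_eq_cons p
  rw [h, h, List.cons_append, List.cons_append]
  exact List.Lex.rel (by omega)

/-- The path sequence determines the tree; the tails `X` and `Y` make the induction go through. -/
theorem eq_of_pathFrom_append_eq {p q : TernaryTree} (d : ℕ) {X Y : List ℕ}
    (h : pathFrom d p ++ X = pathFrom d q ++ Y) : p = q ∧ X = Y := by
  induction p generalizing q d X Y with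
  | leaf =>
    cases q with
    | leaf => simpa [pathFrom] using h
    | node a b c =>
      obtain ⟨k, L, h'⟩ := exists_pathFrom_eq_cons a
      simp only [pathFrom, h', List.cons_append, List.cons.injEq] at h
      omega
  | node a b c iha ihb ihc =>
    cases q with
    | leaf =>
      obtain ⟨k, L, h'⟩ := exists_pathFrom_eq_cons a
      simp only [pathFrom, h', List.cons_append, List.cons.injEq] at h
      omega
    | node a' b' c' =>
      simp only [pathFrom, List.append_assoc] at h
      obtain ⟨rfl, hb⟩ := iha _ h
      obtain ⟨rfl, hc⟩ := ihb _ hb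
      obtain ⟨rfl, hX⟩ := ihc _ hc
      exact ⟨rfl, hX⟩

theorem path_injective : Function.Injective path := fun p q h => by
  rw [path_eq_pathFrom, path_eq_pathFrom] at h
  exact (eq_of_pathFrom_append_eq 0 (congrArg (· ++ []) h)).1

theorem _root_.List.append_lt_append_of_length_eq {L L' : List ℕ} (h : L < L')
    (hl : L.length = L'.length) (X Y : List ℕ) : L ++ X < L' ++ Y := by
  induction h with
  | nil => simp at hl
  | cons _ ih => exact List.Lex.cons (ih (by simpa using hl))
  | rel h => exact List.Lex.rel h

theorem PathLex.pathFrom_append_lt {p q : TernaryTree} (h : PathLex p q)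
    (ha : p.arity = q.arity) (d : ℕ) (X Y : List ℕ) :
    pathFrom d p ++ X < pathFrom d q ++ Y := by
  refine List.append_lt_append_of_length_eq ?_ (by simp [pathFrom_eq_map, length_path, ha]) X Y
  rw [pathFrom_eq_map, pathFrom_eq_map]
  exact List.map_lt (fun _ _ hxy => Nat.add_lt_add_right hxy d) h

theorem PathLex.node_left {p q : TernaryTree} (h : PathLex p q) (ha : p.arity = q.arity)
    (b c : TernaryTree) : PathLex (node p b c) (node q b c) := by
  rw [PathLex, path_node, path_node]
  exact h.pathFrom_append_lt ha 1 _ _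

theorem PathLex.node_middle {p q : TernaryTree} (a : TernaryTree) (h : PathLex p q)
    (ha : p.arity = q.arity) (c : TernaryTree) : PathLex (node a p c) (node a q c) := by
  rw [PathLex, path_node, path_node]
  exact List.append_left_lt (h.pathFrom_append_lt ha 1 _ _)

theorem PathLex.node_right {p q : TernaryTree} (a b : TernaryTree) (h : PathLex p q)
    (ha : p.arity = q.arity) : PathLex (node a b p) (node a b q) := by
  rw [PathLex, path_node, path_node]
  have := h.pathFrom_append_lt ha 1 [] []
  simp only [List.append_nil] at this
  exact List.append_left_lt (List.append_left_lt this)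

instance isStrictOrder_pathLex : IsStrictOrder TernaryTree PathLex where
  irrefl p := lt_irrefl p.path
  trans _ _ _ h h' := lt_trans h h'

/-- There are finitely many trees of bounded arity, so that the path-lexicographic order is
well-founded on the trees of a fixed arity. -/
theorem finite_arity_lt (n : ℕ) : {p : TernaryTree | p.arity < n}.Finite := by
  induction n with
  | zero => simp
  | succ n ih =>
    refine (((ih.prod (ih.prod ih)).image fun x => node x.1 x.2.1 x.2.2).insert leaf).subset ?_
    rintro (_ | ⟨a, b, c⟩) h
    · exact Or.inl rfl
    · have ha := a.arity_pos
      have hb := b.arity_pos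
      have hc := c.arity_pos
      simp only [Set.mem_ofPred_eq, arity] at h
      refine Or.inr ⟨(a, b, c), ⟨?_, ?_, ?_⟩, rfl⟩ <;>
        simp only [Set.mem_ofPred_eq] <;> omega

theorem pathLex_induction {P : TernaryTree → Prop} (p : TernaryTree)
    (h : ∀ p, (∀ q, q.arity = p.arity → PathLex q p → P q) → P p) : P p := by
  have hwf := (finite_arity_lt (p.arity + 1)).wellFoundedOn (r := PathLex)
  refine hwf.induction (P := fun q => q.arity = p.arity → P q) (Nat.lt_succ_self _) ?_ rfl
  intro q _ ih hq
  refine h q fun q' ha hlt => ih q' ?_ hlt (ha.trans hq)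
  rw [Set.mem_ofPred_eq]; omega

/-! ### Trees divisible by a leading monomial -/

/-- A tree is reducible if it contains an occurrence of the leading monomial of one of the five
relations. The occurrence is described by its root and the subtrees hanging from its leaves; see
`Reducible.exists_divides` and `Divides.reducible` for the equivalence with divisibility. -/
inductive Reducible : TernaryTree → Prop
  | alpha (a b c d e : TernaryTree) : Reducible (node (node a b c) d e)
  | beta (a b c d e f g : TernaryTree) : Reducible (node a (node b c (node d e f)) g)
  | eta (a b c d e f g h k : TernaryTree) :
      Reducible (node a (node b c d) (node e (node f g h) k))
  | theta (a b c d e f g h k : TernaryTree) :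
      Reducible (node a b (node c (node d e f) (node g h k)))
  | nu (a b c d e f g h k : TernaryTree) :
      Reducible (node a b (node c d (node e f (node g h k))))
  | left {a : TernaryTree} (b c : TernaryTree) (h : Reducible a) : Reducible (node a b c)
  | middle {b : TernaryTree} (a c : TernaryTree) (h : Reducible b) : Reducible (node a b c)
  | right {c : TernaryTree} (a b : TernaryTree) (h : Reducible c) : Reducible (node a b c)

theorem Reducible.graft_right {p : TernaryTree} (h : Reducible p) (i : ℕ) (q : TernaryTree) :
    Reducible (p.graft i q) := by
  induction h generalizing i with
  | left b c h ih =>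
    simp only [graft]
    split_ifs <;>
      [exact .left _ _ (ih _); exact .left _ _ h; exact .left _ _ h]
  | middle b c h ih =>
    simp only [graft]
    split_ifs <;>
      [exact .middle _ _ h; exact .middle _ _ (ih _); exact .middle _ _ h]
  | right b c h ih =>
    simp only [graft]
    split_ifs <;>
      [exact .right _ _ h; exact .right _ _ h; exact .right _ _ (ih _)]
  | alpha => simp only [graft]; split_ifs <;> exact .alpha ..
  | beta => simp only [graft]; split_ifs <;> exact .beta ..
  | eta => simp only [graft]; split_ifs <;> exact .eta ..
  | theta => simp only [graft]; split_ifs <;> exact .theta ..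
  | nu => simp only [graft]; split_ifs <;> exact .nu ..

theorem Reducible.graft_left {p : TernaryTree} (h : Reducible p) {j : ℕ} (q : TernaryTree)
    (hj : 1 ≤ j) (hj' : j ≤ q.arity) : Reducible (q.graft j p) := by
  induction q generalizing j with
  | leaf =>
    obtain rfl : j = 1 := le_antisymm hj' hj
    simpa [graft] using h
  | node a b c iha ihb ihc =>
    simp only [arity] at hj'
    rw [graft]
    split_ifs with h₁ h₂
    · exact .left _ _ (iha hj h₁)
    · exact .middle _ _ (ihb (by omega) (by omega))
    · exact .right _ _ (ihc (by omega) (by omega))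

theorem Divides.reducible {p q : TernaryTree} (h : Divides p q) (hp : Reducible p) :
    Reducible q := by
  induction h with
  | refl => exact hp
  | graft_right i r _ _ _ ih => exact ih.graft_right i r
  | graft_left j r _ hj hj' ih => exact ih.graft_left r hj hj'

theorem Divides.node_left {p a : TernaryTree} (h : Divides p a) (b c : TernaryTree) :
    Divides p (node a b c) := by
  simpa [graft, arity] using h.graft_left 1 (node leaf b c) le_rfl (by simp only [arity]; omega)

theorem Divides.node_middle {p b : TernaryTree} (a : TernaryTree) (h : Divides p b)
    (c : TernaryTree) : Divides p (node a b c) := by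
  simpa [graft, arity] using h.graft_left (a.arity + 1) (node a leaf c) (by omega)
    (by simp only [arity]; omega)

theorem Divides.node_right {p c : TernaryTree} (a b : TernaryTree) (h : Divides p c) :
    Divides p (node a b c) := by
  have := h.graft_left (a.arity + b.arity + 1) (node a b leaf) (by omega) (by simp [arity])
  rw [graft, if_neg (by omega), if_neg (by omega), Nat.add_sub_cancel_left] at this
  simpa [graft] using this

/-- The leading monomials of the five relations. -/
def leadingTrees : Set TernaryTree :=
  {t.graft 1 t, t.graft 2 (t.graft 3 t), (t.graft 2 t).graft 5 (t.graft 2 t),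
    t.graft 3 ((t.graft 2 t).graft 5 t), t.graft 3 (t.graft 3 (t.graft 3 t))}

theorem reducible_of_mem_leadingTrees {p : TernaryTree} (h : p ∈ leadingTrees) :
    Reducible p := by
  rcases h with rfl | rfl | rfl | rfl | rfl <;> simp only [t, graft, arity] <;> norm_num
  · exact .alpha ..
  · exact .beta ..
  · exact .eta ..
  · exact .theta ..
  · exact .nu ..

/-- The tree `q` is a partial composition of `p` with one tree at a leaf of `p`. -/
def GraftStep (p q : TernaryTree) : Prop :=
  ∃ (i : ℕ) (r : TernaryTree), 1 ≤ i ∧ i ≤ p.arity ∧ q = p.graft i r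

theorem GraftStep.node_left {p q : TernaryTree} (b c : TernaryTree) (h : GraftStep p q) :
    GraftStep (node p b c) (node q b c) := by
  obtain ⟨i, r, hi, hi', rfl⟩ := h
  exact ⟨i, r, hi, by simp only [arity]; omega, by rw [graft, if_pos hi']⟩

theorem GraftStep.node_middle {p q : TernaryTree} (a c : TernaryTree) (h : GraftStep p q) :
    GraftStep (node a p c) (node a q c) := by
  obtain ⟨i, r, hi, hi', rfl⟩ := h
  refine ⟨a.arity + i, r, by omega, by simp only [arity]; omega, ?_⟩
  rw [graft, if_neg (by omega), if_pos (by omega), Nat.add_sub_cancel_left]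

theorem GraftStep.node_right {p q : TernaryTree} (a b : TernaryTree) (h : GraftStep p q) :
    GraftStep (node a b p) (node a b q) := by
  obtain ⟨i, r, hi, hi', rfl⟩ := h
  refine ⟨a.arity + b.arity + i, r, by omega, by simp only [arity]; omega, ?_⟩
  rw [graft, if_neg (by omega), if_neg (by omega), Nat.add_sub_cancel_left]

/-- `Extends p q`: the tree `q` is obtained from `p` by replacing each leaf by some tree. -/
inductive Extends : TernaryTree → TernaryTree → Prop
  | leaf (q : TernaryTree) : Extends leaf q
  | node {a b c a' b' c' : TernaryTree} (ha : Extends a a') (hb : Extends b b')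
      (hc : Extends c c') : Extends (node a b c) (node a' b' c')

theorem Extends.divides {p q : TernaryTree} (h : Extends p q) : Divides p q := by
  have key : Relation.ReflTransGen GraftStep p q := by
    induction h with
    | leaf q => exact .single ⟨1, q, le_rfl, le_rfl, by simp [graft]⟩
    | @node a b c a' b' c' _ _ _ iha ihb ihc =>
      exact ((iha.lift (TernaryTree.node · b c) fun _ _ h => h.node_left b c).trans
        (ihb.lift (TernaryTree.node a' · c) fun _ _ h => h.node_middle a' c)).trans
        (ihc.lift (TernaryTree.node a' b' ·) fun _ _ h => h.node_right a' b')
  clear h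
  induction key with
  | refl => exact .refl
  | tail _ h ih =>
    obtain ⟨i, r, hi, hi', rfl⟩ := h
    exact ih.graft_right i r hi hi'

theorem Reducible.exists_divides {p : TernaryTree} (h : Reducible p) :
    ∃ q ∈ leadingTrees, Divides q p := by
  induction h with
  | left b c _ ih => obtain ⟨q, hq, h⟩ := ih; exact ⟨q, hq, h.node_left b c⟩
  | middle a c _ ih => obtain ⟨q, hq, h⟩ := ih; exact ⟨q, hq, h.node_middle a c⟩
  | right a b _ ih => obtain ⟨q, hq, h⟩ := ih; exact ⟨q, hq, h.node_right a b⟩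
  | alpha =>
    refine ⟨_, Or.inl rfl, Extends.divides ?_⟩
    simp only [t, graft, arity]
    norm_num
    repeat constructor
  | beta =>
    refine ⟨_, Or.inr (Or.inl rfl), Extends.divides ?_⟩
    simp only [t, graft, arity]
    norm_num
    repeat constructor
  | eta =>
    refine ⟨_, Or.inr (Or.inr (Or.inl rfl)), Extends.divides ?_⟩
    simp only [t, graft, arity]
    norm_num
    repeat constructor
  | theta =>
    refine ⟨_, Or.inr (Or.inr (Or.inr (Or.inl rfl))), Extends.divides ?_⟩
    simp only [t, graft, arity]
    norm_num
    repeat constructor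
  | nu =>
    refine ⟨_, Or.inr (Or.inr (Or.inr (Or.inr rfl))), Extends.divides ?_⟩
    simp only [t, graft, arity]
    norm_num
    repeat constructor

end TernaryTree

/-! ### A ternary partially associative algebra -/

/-- The index set of the irreducible trees; see `NormalForm.tree` for the tree attached to an index.
With `P a b = (∗ (M a) (∗ ∗ (M b)))`, the indices `s l` and `p j l` stand for `P 0 (l + 1)` and
`P (j + 1) l`. The tree `P 0 0 = (∗ ∗ (M 1))` has the index `r 0`. -/
inductive NormalForm : Type
  | m (k : ℕ) : NormalForm
  | r (k : ℕ) : NormalForm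
  | s (l : ℕ) : NormalForm
  | p (j l : ℕ) : NormalForm

namespace NormalForm
variable {K : Type*} [Field K]

/-- The coefficient of a vector at the tree `(∗ ∗ (M (n - 1)))` of weight `n ≥ 2`, extended by `0`.
For `n = 1` this tree is `M 1`, which is not counted. -/
def rightCoeff (v : NormalForm → K) : ℕ → K
  | 0 => 0
  | 1 => 0
  | n + 2 => v (r n)

/-- A functional on the vectors of weight `n`, up to sign the only one through which the third
factor `w` enters a product `(x, v, w)` of the generator `x` and vectors `v, w` of positive weight.
It kills the vector `M 2 + R 2`, `M 3 - R 3`, and so on, where `R n = (∗ ∗ (M (n - 1)))`. -/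
def coeffThird (v : NormalForm → K) : ℕ → K
  | 0 => 0
  | n + 1 => (-1) ^ n * v (m (n + 1)) + rightCoeff v (n + 1)

/-- A functional on the vectors of weight `n`: the coefficient of the first factor `u` at
`M (n + 1)` in the product `(u, x, x)` with the generator `x`. -/
def coeffFirst (v : NormalForm → K) : ℕ → K
  | 0 => 0
  | n + 1 => (-1) ^ (n + 1) * v (m (n + 1)) - rightCoeff v (n + 1)

/-- The ternary product, in coordinates, where the generator is the basis vector `m 0`. Each term
has a factor `u (m 0)`, `v (m 0)` or `w (m 0)`: a product of three vectors of positive weight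
vanishes. The coordinates of the arguments at `s` and `p` do not occur. All functions on the index
set are allowed as vectors, not only the finitely supported ones: each coordinate of a product is a
polynomial in finitely many coordinates of the factors. -/
def mul (u v w : NormalForm → K) : NormalForm → K
  | m 0 => 0
  | m 1 => u (m 0) * v (m 0) * w (m 0)
  | m (n + 2) => u (m 0) * w (m 0) * v (m (n + 1)) + v (m 0) * w (m 0) * coeffFirst u (n + 1)
  | r n => u (m 0) * v (m 0) * w (m (n + 1)) - u (m 0) * w (m 0) * rightCoeff v (n + 1)
      + (-1) ^ n * (v (m 0) * w (m 0) * coeffFirst u (n + 1))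
  | s l => u (m 0) * v (m 0) * w (r l) - (-1) ^ l * (u (m 0) * w (m 0) * v (r l))
      + v (m 0) * w (m 0) * coeffThird u (l + 2) - v (m 0) * u (m 1) * w (m (l + 1))
      + w (m 0) * u (m 1) * coeffThird v (l + 1)
  | p j l => u (m 0) * v (m (j + 1)) * coeffThird w (l + 1)
      + v (m 0) * coeffFirst u (j + 1) * coeffThird w (l + 1)
      - v (m 0) * u (m (j + 2)) * w (m l) + w (m 0) * u (m (j + 2)) * coeffThird v l

/-- Partial associativity, which in each coordinate is a polynomial identity in the coordinates of
the arguments. -/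
theorem mul_assoc_sum (a b c d e : NormalForm → K) :
    mul (mul a b c) d e + mul a (mul b c d) e + mul a b (mul c d e) = 0 := by
  funext i
  have sq (n : ℕ) : ((-1 : K) ^ n) ^ 2 = 1 := by rw [← pow_mul, mul_comm, pow_mul]; simp
  rcases i with (_ | _ | _ | k) | (_ | k) | (_ | l) | ⟨_ | j, _ | _ | l⟩ <;>
    simp only [mul, coeffFirst, coeffThird, rightCoeff, Pi.add_apply, Pi.zero_apply]
  case s.succ =>
    linear_combination (d (m 0) * e (m 0) * a (m 0) *
      (c (m 0) * b (r l) - b (m 0) * c (m (l + 2))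
        - (-1) ^ l * (c (m 0) * b (m (l + 2))))) * sq l
  all_goals ring

/-- The value of a tree in the algebra of `NormalForm.mul`, with the vectors `v 0, v 1, …` at its
leaves from left to right (numbered from `0` here, whereas `graft` counts from `1`). -/
def eval : TernaryTree → (ℕ → NormalForm → K) → NormalForm → K
  | .leaf, v => v 0
  | .node a b c, v => mul (eval a v) (eval b fun n => v (n + a.arity))
      (eval c fun n => v (n + a.arity + b.arity))

theorem eval_congr (p : TernaryTree) {v v' : ℕ → NormalForm → K}
    (h : ∀ n < p.arity, v n = v' n) : eval p v = eval p v' := by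
  induction p generalizing v v' with
  | leaf => exact h 0 Nat.one_pos
  | node a b c iha ihb ihc =>
    simp only [eval]
    rw [iha fun n hn => h n (by simp only [arity]; omega),
      ihb fun n hn => h (n + a.arity) (by simp only [arity]; omega),
      ihc fun n hn => h (n + a.arity + b.arity) (by simp only [arity]; omega)]

theorem eval_graft (p q : TernaryTree) {i : ℕ} (hi : i < p.arity) (v : ℕ → NormalForm → K) :
    eval (p.graft (i + 1) q) v = eval p fun n =>
      if n < i then v n else if n = i then eval q (fun n => v (n + i))
      else v (n + q.arity - 1) := by
  induction p generalizing i v with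
  | leaf =>
    obtain rfl : i = 0 := by simpa [arity] using hi
    simp [graft, eval]
  | node a b c iha ihb ihc =>
    have hq := q.arity_pos
    simp only [arity] at hi
    rw [graft]
    split_ifs with h₁ h₂
    · have := arity_graft a q (i := i) (by omega)
      simp only [eval]
      rw [iha (by omega)]
      congr 2
      all_goals
        funext n
        rw [if_neg (by omega), if_neg (by omega)]
        congr 1; omega
    · obtain ⟨j, rfl⟩ : ∃ j, i = a.arity + j := ⟨i - a.arity, by omega⟩
      have := arity_graft b q (i := j) (by omega)
      simp only [eval]
      rw [show a.arity + j + 1 - a.arity = j + 1 by omega, ihb (by omega)]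
      congr 1
      · refine eval_congr a fun n hn => ?_
        rw [if_pos (by omega)]
      · congr 1
        funext n
        have h₁ : n + a.arity < a.arity + j ↔ n < j := by omega
        have h₂ : n + a.arity = a.arity + j ↔ n = j := by omega
        simp only [h₁, h₂]
        split_ifs
        · rfl
        · congr 1; funext m; congr 1; omega
        · congr 1; omega
      · congr 1
        funext n
        rw [if_neg (by omega), if_neg (by omega)]
        congr 1; omega
    · obtain ⟨j, rfl⟩ : ∃ j, i = a.arity + b.arity + j :=
        ⟨i - (a.arity + b.arity), by omega⟩
      simp only [eval]
      rw [show a.arity + b.arity + j + 1 - (a.arity + b.arity) = j + 1 by omega, ihc (by omega)]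
      congr 1
      · refine eval_congr a fun n hn => ?_
        rw [if_pos (by omega)]
      · refine eval_congr b fun n hn => ?_
        rw [if_pos (by omega)]
      · congr 1
        funext n
        have h₁ : n + a.arity + b.arity < a.arity + b.arity + j ↔ n < j := by omega
        have h₂ : n + a.arity + b.arity = a.arity + b.arity + j ↔ n = j := by omega
        simp only [h₁, h₂]
        split_ifs
        · rfl
        · congr 1; funext m; congr 1; omega
        · congr 1; omega

theorem rightCoeff_add (u v : NormalForm → K) (n : ℕ) :
    rightCoeff (u + v) n = rightCoeff u n + rightCoeff v n := by
  rcases n with _ | _ | n <;> simp [rightCoeff]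

theorem rightCoeff_smul (c : K) (v : NormalForm → K) (n : ℕ) :
    rightCoeff (c • v) n = c * rightCoeff v n := by
  rcases n with _ | _ | n <;> simp [rightCoeff]

theorem coeffThird_add (u v : NormalForm → K) (n : ℕ) :
    coeffThird (u + v) n = coeffThird u n + coeffThird v n := by
  rcases n with _ | n <;> simp [coeffThird, rightCoeff_add]; ring

theorem coeffThird_smul (c : K) (v : NormalForm → K) (n : ℕ) :
    coeffThird (c • v) n = c * coeffThird v n := by
  rcases n with _ | n <;> simp [coeffThird, rightCoeff_smul]; ring

theorem coeffFirst_add (u v : NormalForm → K) (n : ℕ) :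
    coeffFirst (u + v) n = coeffFirst u n + coeffFirst v n := by
  rcases n with _ | n <;> simp [coeffFirst, rightCoeff_add]; ring

theorem coeffFirst_smul (c : K) (v : NormalForm → K) (n : ℕ) :
    coeffFirst (c • v) n = c * coeffFirst v n := by
  rcases n with _ | n <;> simp [coeffFirst, rightCoeff_smul]; ring

theorem isLinearMap_mul_left (v w : NormalForm → K) : IsLinearMap K fun u => mul u v w := by
  constructor <;> intros <;> funext i <;> rcases i with (_ | _ | k) | k | l | ⟨j, l⟩ <;>
    simp only [mul, coeffThird_add, coeffThird_smul,
      coeffFirst_add, coeffFirst_smul, Pi.add_apply, Pi.smul_apply, smul_eq_mul] <;> ring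

theorem isLinearMap_mul_middle (u w : NormalForm → K) : IsLinearMap K fun v => mul u v w := by
  constructor <;> intros <;> funext i <;> rcases i with (_ | _ | k) | k | l | ⟨j, l⟩ <;>
    simp only [mul, rightCoeff_add, rightCoeff_smul, coeffThird_add, coeffThird_smul,
      Pi.add_apply, Pi.smul_apply, smul_eq_mul] <;> ring

theorem isLinearMap_mul_right (u v : NormalForm → K) : IsLinearMap K fun w => mul u v w := by
  constructor <;> intros <;> funext i <;> rcases i with (_ | _ | k) | k | l | ⟨j, l⟩ <;>
    simp only [mul, coeffThird_add, coeffThird_smul,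
      Pi.add_apply, Pi.smul_apply, smul_eq_mul] <;> ring

theorem isLinearMap_eval (p : TernaryTree) {i : ℕ} (hi : i < p.arity)
    (v : ℕ → NormalForm → K) :
    IsLinearMap K fun w => eval p fun n => if n = i then w else v n := by
  induction p generalizing i v with
  | leaf =>
    obtain rfl : i = 0 := by simpa [arity] using hi
    exact (LinearMap.id : (NormalForm → K) →ₗ[K] NormalForm → K).isLinear
  | node a b c iha ihb ihc =>
    simp only [arity] at hi
    simp only [eval]
    rcases lt_or_ge i a.arity with h₁ | h₁
    · have h := iha h₁ v
      have hb (n : ℕ) : n + a.arity ≠ i := by omega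
      have hc (n : ℕ) : n + a.arity + b.arity ≠ i := by omega
      simp only [hb, hc, if_false]
      exact ((isLinearMap_mul_left _ _).mk'.comp h.mk').isLinear
    have ha (w : NormalForm → K) : eval a (fun n => if n = i then w else v n) = eval a v :=
      eval_congr a fun n hn => if_neg (by omega)
    obtain ⟨j, rfl⟩ := Nat.exists_eq_add_of_le' h₁
    simp only [ha, Nat.add_right_cancel_iff]
    rcases lt_or_ge j b.arity with h₂ | h₂
    · have h := ihb h₂ fun n => v (n + a.arity)
      have hc (n : ℕ) : n + a.arity + b.arity ≠ j + a.arity := by omega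
      simp only [hc, if_false]
      exact ((isLinearMap_mul_middle _ _).mk'.comp h.mk').isLinear
    have hb (w : NormalForm → K) : eval b (fun n => if n = j then w else v (n + a.arity)) =
        eval b fun n => v (n + a.arity) :=
      eval_congr b fun n hn => if_neg (by omega)
    obtain ⟨k, rfl⟩ := Nat.exists_eq_add_of_le' h₂
    have h := ihc (i := k) (by omega) fun n => v (n + a.arity + b.arity)
    have hc (n : ℕ) : n + a.arity + b.arity = k + b.arity + a.arity ↔ n = k := by omega
    simp only [hb, hc]
    exact ((isLinearMap_mul_right _ _).mk'.comp h.mk').isLinear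

variable (K) in
/-- The multilinear identities of the algebra of `NormalForm.mul`: the elements of the free operad
each of whose homogeneous components vanishes under all evaluations. -/
def identities : Submodule K (FreeTernary K) :=
  ⨅ (n : ℕ) (v : ℕ → NormalForm → K), LinearMap.ker
    (Finsupp.linearCombination K fun p => if p.arity = n then eval p v else 0)

theorem mem_identities {f : FreeTernary K} : f ∈ identities K ↔
    ∀ (n : ℕ) (v : ℕ → NormalForm → K), (f.sum fun p c =>
      c • if p.arity = n then eval p v else 0) = 0 := by
  simp [identities, Finsupp.linearCombination_apply]

theorem sum_comp {W : Type*} [AddCommGroup W] [Module K W] (f g : FreeTernary K) (i : ℕ)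
    (F : TernaryTree → W) : ((f.comp i g).sum fun p c => c • F p) =
      f.sum fun p a => g.sum fun q b => (a * b) • F (p.graft i q) := by
  simp only [← Finsupp.linearCombination_apply K]
  rw [FreeTernary.comp, map_finsuppSum]
  simp only [map_finsuppSum, Finsupp.linearCombination_single]

/-- Grafting corresponds to substituting a value at one leaf (`eval_graft`), and values are linear
in the vector at each leaf (`isLinearMap_eval`). -/
theorem isOperadIdeal_identities : FreeTernary.IsOperadIdeal (identities K) := by
  constructor
  · intro f hf n
    rw [mem_identities] at hf ⊢
    intro n' v
    rw [Finsupp.sum, Finsupp.support_filter, Finset.sum_filter]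
    rcases eq_or_ne n' n with rfl | h
    · refine (Finset.sum_congr rfl fun p _ => ?_).trans (hf n' v)
      by_cases hp : p.arity = n' <;> simp [hp]
    · refine Finset.sum_eq_zero fun p _ => ?_
      split_ifs <;> simp_all
  · intro m n f g hf hfm hgn i hi him
    rw [mem_identities] at hf ⊢
    intro N v
    obtain ⟨i, rfl⟩ := Nat.exists_eq_add_of_le' hi
    rw [sum_comp, Finsupp.sum_comm]
    refine Finset.sum_eq_zero fun q hq => ?_
    have hqn : q.arity = n := (Finsupp.mem_supported K g).1 hgn hq
    by_cases hN : N + 1 = m + n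
    · have h := congrArg (g q • ·) (hf m fun k =>
        if k < i then v k else if k = i then eval q (fun k => v (k + i))
        else v (k + q.arity - 1))
      simp only [Finsupp.sum, Finset.smul_sum, smul_zero] at h
      rw [← h]
      refine Finset.sum_congr rfl fun p hp => ?_
      have hpm : p.arity = m := (Finsupp.mem_supported K f).1 hfm hp
      have := arity_graft p q (i := i) (by omega)
      dsimp only
      rw [if_pos (by omega), if_pos hpm, eval_graft p q (by omega), mul_comm, mul_smul]
    · refine Finset.sum_eq_zero fun p hp => ?_
      have hpm : p.arity = m := (Finsupp.mem_supported K f).1 hfm hp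
      have := arity_graft p q (i := i) (by omega)
      dsimp only
      rw [if_neg (by omega), smul_zero]
  · intro m n f g hf hfm hgn i hi hin
    rw [mem_identities] at hf ⊢
    intro N v
    obtain ⟨i, rfl⟩ := Nat.exists_eq_add_of_le' hi
    rw [sum_comp]
    refine Finset.sum_eq_zero fun q hq => ?_
    have hqn : q.arity = n := (Finsupp.mem_supported K g).1 hgn hq
    by_cases hN : N + 1 = m + n
    · have h := isLinearMap_eval q (i := i) (by omega) fun k =>
        if k < i then v k else v (k + m - 1)
      have h := congrArg (g q • ·)
        ((congrArg h.mk' (hf m fun k => v (k + i))).trans (map_zero _))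
      simp only [Finsupp.sum, map_sum, map_smul, Finset.smul_sum, smul_zero,
        IsLinearMap.mk'_apply] at h
      rw [← h]
      refine Finset.sum_congr rfl fun p hp => ?_
      have hpm : p.arity = m := (Finsupp.mem_supported K f).1 hfm hp
      have := arity_graft q p (i := i) (by omega)
      dsimp only
      rw [if_pos (by omega), if_pos hpm, eval_graft q p (by omega), mul_smul]
      congr 3
      funext k
      split_ifs <;> first | rfl | omega | rw [hpm]
    · refine Finset.sum_eq_zero fun p hp => ?_
      have hpm : p.arity = m := (Finsupp.mem_supported K f).1 hfm hp
      have := arity_graft q p (i := i) (by omega)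
      dsimp only
      rw [if_neg (by omega), smul_zero]

theorem alpha_mem_identities : FreeTernary.alpha K ∈ identities K := by
  rw [mem_identities]
  intro n v
  rw [FreeTernary.alpha, FreeTernary.mono, FreeTernary.mono, FreeTernary.mono,
    ← Finsupp.linearCombination_apply K, map_add, map_add]
  simp only [Finsupp.linearCombination_single, one_smul]
  by_cases hn : n = 5
  · subst hn
    have := mul_assoc_sum (v 0) (v 1) (v 2) (v 3) (v 4)
    simpa [t, graft, arity, eval] using this
  · simp [t, graft, arity, Ne.symm hn]

/-! ### The irreducible trees -/

/-- The irreducible tree with a given index. -/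
def tree : NormalForm → TernaryTree
  | m k => M k
  | r k => .node .leaf .leaf (M (k + 1))
  | s l => .node .leaf .leaf (.node .leaf .leaf (M (l + 1)))
  | p j l => .node .leaf (M (j + 1)) (.node .leaf .leaf (M l))

open Classical in
/-- With the generator at every leaf, an irreducible tree evaluates to the basis vector of its
index. -/
theorem eval_tree (i : NormalForm) :
    eval (tree i) (fun _ => Pi.single (m 0) (1 : K)) = Pi.single i 1 := by
  have hM (k : ℕ) : eval (M k) (fun _ => Pi.single (m 0) (1 : K)) = Pi.single (m k) 1 := by
    induction k with
    | zero => simp [M, eval]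
    | succ k ih =>
      rw [M_succ, eval, ih]
      funext i
      rcases i with (_ | _ | _ | k) | (_ | k) | (_ | l) | ⟨_ | j, _ | _ | l⟩ <;>
        simp [mul, eval, coeffFirst, coeffThird, rightCoeff, Pi.single_apply] <;> grind
  have hR (k : ℕ) : eval (.node .leaf .leaf (M (k + 1))) (fun _ => Pi.single (m 0) (1 : K)) =
      Pi.single (r k) 1 := by
    rw [eval, hM]
    funext i
    rcases i with (_ | _ | _ | k) | (_ | k) | (_ | l) | ⟨_ | j, _ | _ | l⟩ <;>
      simp [mul, eval, coeffFirst, coeffThird, rightCoeff, Pi.single_apply]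
    grind
  rcases i with k | k | l | ⟨j, l⟩
  · exact hM k
  · exact hR k
  · rw [tree, eval, hR]
    funext i
    rcases i with (_ | _ | _ | k) | (_ | k) | (_ | l) | ⟨_ | j, _ | _ | l⟩ <;>
      simp [mul, eval, coeffFirst, coeffThird, rightCoeff, Pi.single_apply]
  · rw [tree, eval, hM]
    rcases l with _ | l
    · -- The right subtree `(∗ ∗ (M 0))` is `M 1`, which is not one of the trees of `hR`.
      rw [show M 0 = .leaf from rfl, ← show M 1 = .node .leaf .leaf .leaf from M_succ 0, hM]
      funext i
      rcases i with (_ | _ | _ | k) | (_ | k) | (_ | l) | ⟨_ | j, _ | _ | l⟩ <;>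
        simp [mul, eval, coeffFirst, coeffThird, rightCoeff, Pi.single_apply]
      grind
    · rw [hR]
      funext i
      rcases i with (_ | _ | _ | k) | (_ | k) | (_ | l) | ⟨_ | j, _ | _ | l⟩ <;>
        simp [mul, eval, coeffFirst, coeffThird, rightCoeff, Pi.single_apply] <;> grind

theorem not_reducible_node_leaf_leaf_leaf : ¬ Reducible (.node .leaf .leaf .leaf) := by
  rintro (_ | _ | _ | _ | _ | ⟨_, _, h⟩ | ⟨_, _, h⟩ | ⟨_, _, h⟩) <;> cases h

theorem not_reducible_M (k : ℕ) : ¬ Reducible (M k) := by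
  induction k with
  | zero => exact nofun
  | succ k ih =>
    intro h
    rcases k with _ | k
    · rw [M_succ] at h
      exact not_reducible_node_leaf_leaf_leaf h
    · rw [M_succ, M_succ] at h
      rw [M_succ] at ih
      generalize M k = q at *
      cases h with
      | left _ _ h => cases h
      | right _ _ h => cases h
      | middle _ _ h => exact ih h

theorem not_reducible_right (k : ℕ) : ¬ Reducible (.node .leaf .leaf (M k)) := by
  have := not_reducible_M k
  rcases k with _ | k
  · exact not_reducible_node_leaf_leaf_leaf
  · rw [M_succ] at *
    generalize M k = q at *
    intro h
    cases h with
    | left _ _ h => cases h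
    | middle _ _ h => cases h
    | right _ _ h => exact this h

theorem not_reducible_tree (i : NormalForm) : ¬ Reducible (tree i) := by
  rcases i with k | k | l | ⟨j, l⟩
  · exact not_reducible_M k
  · exact not_reducible_right (k + 1)
  · have := not_reducible_right (l + 1)
    rw [tree]
    rw [M_succ] at *
    generalize M l = q at *
    intro h
    cases h with
    | left _ _ h => cases h
    | middle _ _ h => cases h
    | right _ _ h => exact this h
  · have := not_reducible_right l
    have hM := not_reducible_M (j + 1)
    rw [tree]
    rw [M_succ] at *
    intro h
    rcases l with _ | l
    · simp only [M] at *
      generalize M j = q at *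
      cases h with
      | left _ _ h => cases h
      | middle _ _ h => exact hM h
      | right _ _ h => exact this h
    · rw [M_succ] at *
      generalize M l = q at *
      generalize M j = q' at *
      cases h with
      | left _ _ h => cases h
      | middle _ _ h => exact hM h
      | right _ _ h => exact this h

theorem exists_tree_eq {p : TernaryTree} (h : ¬ Reducible p) : ∃ i, tree i = p := by
  induction p with
  | leaf => exact ⟨m 0, rfl⟩
  | node a b c iha ihb ihc =>
    have ha : a = .leaf := by
      cases a with
      | leaf => rfl
      | node => exact absurd (.alpha ..) h
    subst ha
    obtain ⟨i, rfl⟩ := ihb fun hb => h (.middle _ _ hb)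
    obtain ⟨i', rfl⟩ := ihc fun hc => h (.right _ _ hc)
    -- A middle child other than some `M k` has a nonleaf as its right child, as in `beta`.
    have hb : ∃ k, i = m k := by
      rcases i with k | k | l | ⟨j, l⟩
      · exact ⟨k, rfl⟩
      all_goals
        refine absurd ?_ h
        simp only [tree, M_succ]
        exact .beta ..
    obtain ⟨k, rfl⟩ := hb
    rcases i' with k' | k' | l | ⟨j, l⟩
    · rcases k' with _ | k'
      · exact ⟨m (k + 1), M_succ k⟩
      · rcases k with _ | k
        · exact ⟨r k', rfl⟩
        · rcases k' with _ | k'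
          · exact ⟨p k 0, by rw [tree, tree, tree, M_succ 0]; rfl⟩
          · refine absurd ?_ h
            simp only [tree, M_succ]
            exact .eta ..
    · rcases k with _ | k
      · exact ⟨s k', rfl⟩
      · exact ⟨p k (k' + 1), rfl⟩
    · refine absurd ?_ h
      simp only [tree, M_succ]
      exact .nu ..
    · refine absurd ?_ h
      simp only [tree, M_succ]
      exact .theta ..

theorem not_reducible_iff {p : TernaryTree} : ¬ Reducible p ↔ p ∈ Set.range tree :=
  ⟨exists_tree_eq, by rintro ⟨i, rfl⟩; exact not_reducible_tree i⟩

/-- The values of the trees `tree i` in the algebra tell them apart. -/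
theorem tree_injective : Function.Injective tree := by
  classical
  intro i j h
  have := (eval_tree (K := ℚ) i).symm.trans ((congrArg (eval · _) h).trans (eval_tree j))
  by_contra hij
  have := congrFun this i
  simp [hij] at this

/-- The index of the tree `normalTree k (i + 1)`, for `k ≥ 3` and `i ≤ k`. -/
def ofIndex (k i : ℕ) : NormalForm :=
  if i = 0 then s (k - 3) else if i = 1 then r (k - 2)
  else if i < k then p (i - 2) (k - i - 1) else m k

theorem normalTree_eq_tree {k i : ℕ} (hk : 3 ≤ k) :
    normalTree k (i + 1) = tree (ofIndex k i) := by
  have hM (q : TernaryTree) : t.graft 3 q = .node .leaf .leaf q := by simp [t, graft, arity]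
  rw [normalTree, ofIndex]
  split_ifs <;> first | omega | simp only [hM, tree]
  · rw [show k - 3 + 1 = k - 2 by omega]
  · rw [show k - 2 + 1 = k - 1 by omega]
  · rw [show i - 2 + 1 = i + 1 - 2 by omega, show k - i - 1 = k - (i + 1) by omega]
    simp [graft, arity]

theorem arity_tree (i : NormalForm) : (tree i).arity = match i with
    | m k => 2 * k + 1
    | r k => 2 * k + 5
    | s l => 2 * l + 7
    | p j l => 2 * j + 2 * l + 7 := by
  rcases i with k | k | l | ⟨j, l⟩ <;> simp only [tree, arity, arity_M] <;> omega

theorem ofIndex_injective (k : ℕ) :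
    Function.Injective fun i : Fin (k + 1) => ofIndex k i := by
  rintro ⟨i, hi⟩ ⟨j, hj⟩ h
  simp only [ofIndex] at h
  rw [Fin.mk.injEq]
  split_ifs at h <;> simp at h <;> omega

theorem range_ofIndex {k : ℕ} (hk : 3 ≤ k) :
    Set.range (fun i : Fin (k + 1) => ofIndex k i) = {i | (tree i).arity = 2 * k + 1} := by
  ext i
  simp only [Set.mem_range, Set.mem_ofPred_eq, arity_tree]
  constructor
  · rintro ⟨⟨j, hj⟩, rfl⟩
    simp only [ofIndex]
    split_ifs <;> simp only <;> omega
  · intro h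
    rcases i with k' | k' | l | ⟨j, l⟩ <;> simp only at h
    · exact ⟨⟨k, by omega⟩, by simp [ofIndex]; grind⟩
    · exact ⟨⟨1, by omega⟩, by simp [ofIndex]; omega⟩
    · exact ⟨⟨0, by omega⟩, by simp [ofIndex]; omega⟩
    · exact ⟨⟨j + 2, by omega⟩, by simp [ofIndex]; grind⟩

theorem range_normalTree {k : ℕ} (hk : 3 ≤ k) :
    Set.range (fun i : Fin (k + 1) => normalTree k (i + 1)) =
      {p | p.arity = 2 * k + 1 ∧ ¬ Reducible p} := by
  simp only [normalTree_eq_tree hk]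
  rw [Set.range_comp' tree, range_ofIndex hk]
  ext p
  simp only [Set.mem_image, Set.mem_ofPred_eq, not_reducible_iff, Set.mem_range]
  constructor
  · rintro ⟨i, hi, rfl⟩
    exact ⟨hi, i, rfl⟩
  · rintro ⟨hi, i, rfl⟩
    exact ⟨i, hi, rfl⟩

theorem normalTree_injective {k : ℕ} (hk : 3 ≤ k) :
    Function.Injective fun i : Fin (k + 1) => normalTree k (i + 1) := by
  simp only [normalTree_eq_tree hk]
  exact tree_injective.comp (ofIndex_injective k)

end NormalForm

/-! ### Operad ideals -/

namespace FreeTernary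
variable {K : Type*} [Field K]

theorem isOperadIdeal_operadIdeal (G : Set (FreeTernary K)) : IsOperadIdeal (operadIdeal G) := by
  constructor
  · intro f hf n
    exact Submodule.mem_sInf.2 fun S hS => hS.1.homogeneous f (Submodule.mem_sInf.1 hf S hS) n
  · intro m n f g hf hfm hgn i hi hi'
    exact Submodule.mem_sInf.2 fun S hS =>
      hS.1.comp_right m n f g (Submodule.mem_sInf.1 hf S hS) hfm hgn i hi hi'
  · intro m n f g hf hfm hgn i hi hi'
    exact Submodule.mem_sInf.2 fun S hS =>
      hS.1.comp_left m n f g (Submodule.mem_sInf.1 hf S hS) hfm hgn i hi hi'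

theorem operadIdeal_le {G : Set (FreeTernary K)} {S : Submodule K (FreeTernary K)}
    (hS : IsOperadIdeal S) (hG : G ⊆ S) : operadIdeal G ≤ S := sInf_le ⟨hS, hG⟩

theorem subset_operadIdeal (G : Set (FreeTernary K)) : G ⊆ operadIdeal G := fun _ hg =>
  Submodule.mem_sInf.2 fun _ hS => hS.2 hg

theorem mono_mem_component {p : TernaryTree} {n : ℕ} (h : p.arity = n) :
    mono K p ∈ component K n := Finsupp.single_mem_supported K 1 h

theorem mono_comp_mono (p q : TernaryTree) (i : ℕ) :
    (mono K p).comp i (mono K q) = mono K (p.graft i q) := by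
  rw [comp, mono, mono, Finsupp.sum_single_index, Finsupp.sum_single_index, one_mul, mono] <;>
    simp

theorem add_comp (f f' g : FreeTernary K) (i : ℕ) :
    (f + f').comp i g = f.comp i g + f'.comp i g := by
  classical
  refine Finsupp.sum_add_index' (by simp) fun p a b => ?_
  simp only [add_mul, Finsupp.single_add, Finsupp.sum, Finset.sum_add_distrib]

theorem mono_comp (p : TernaryTree) (i : ℕ) (f : FreeTernary K) :
    (mono K p).comp i f = Finsupp.lmapDomain K K (p.graft i) f := by
  rw [comp, mono, Finsupp.sum_single_index (by simp)]
  simp [Finsupp.mapDomain]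

/-- Grafting all terms of an element of an operad ideal on a fixed leaf stays in the ideal, also for
inhomogeneous elements. -/
theorem IsOperadIdeal.lmapDomain_graft_mem {S : Submodule K (FreeTernary K)}
    (hS : IsOperadIdeal S) {f : FreeTernary K} (hf : f ∈ S) (p : TernaryTree) {i : ℕ}
    (hi : 1 ≤ i) (hi' : i ≤ p.arity) : Finsupp.lmapDomain K K (p.graft i) f ∈ S := by
  classical
  have hsum : f = ∑ n ∈ f.support.image arity, f.filter (fun q => q.arity = n) := by
    ext q
    rw [Finsupp.finsetSum_apply]
    simp only [Finsupp.filter_apply, Finset.sum_ite_eq, Finset.mem_image]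
    split_ifs with h
    · rfl
    · by_contra hq
      exact h ⟨q, Finsupp.mem_support_iff.2 hq, rfl⟩
  rw [hsum, map_sum]
  refine Submodule.sum_mem _ fun n _ => ?_
  rw [← mono_comp]
  refine hS.comp_left n p.arity _ _ (hS.homogeneous f hf n) ?_ (mono_mem_component rfl) i hi hi'
  refine (Finsupp.mem_supported _ _).2 fun q hq => ?_
  rw [Finset.mem_coe, Finsupp.support_filter, Finset.mem_filter] at hq
  exact hq.2

end FreeTernary

/-! ### Consequences of partial associativity -/

namespace TPA
open FreeTernary
variable {K : Type*} [Field K]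

theorem mono_add_eq_zero_iff {p q r : TernaryTree} :
    TPA.mono K p + TPA.mono K q + TPA.mono K r = 0 ↔
      FreeTernary.mono K p + FreeTernary.mono K q + FreeTernary.mono K r ∈ tpaIdeal K := by
  rw [TPA.mono, TPA.mono, TPA.mono, ← map_add, ← map_add, Submodule.mkQ_apply,
    Submodule.Quotient.mk_eq_zero]

theorem add_eq_zero_of_graft_right {p q r : TernaryTree}
    (h : TPA.mono K p + TPA.mono K q + TPA.mono K r = 0)
    (i : ℕ) (s : TernaryTree) {p' q' r' : TernaryTree}
    (hq : q.arity = p.arity) (hr : r.arity = p.arity) (hi : 1 ≤ i) (hi' : i ≤ p.arity)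
    (hp' : p.graft i s = p') (hq' : q.graft i s = q') (hr' : r.graft i s = r') :
    TPA.mono K p' + TPA.mono K q' + TPA.mono K r' = 0 := by
  subst hp' hq' hr'
  rw [mono_add_eq_zero_iff] at h ⊢
  have := (isOperadIdeal_operadIdeal _).comp_right p.arity s.arity _ (FreeTernary.mono K s) h
    (add_mem (add_mem (mono_mem_component rfl) (mono_mem_component hq)) (mono_mem_component hr))
    (mono_mem_component rfl) i hi hi'
  simp only [add_comp, mono_comp_mono] at this
  exact this

theorem tpaIdeal_le_comap_lmapDomain (p : TernaryTree) {i : ℕ} (hi : 1 ≤ i)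
    (hi' : i ≤ p.arity) :
    tpaIdeal K ≤ (tpaIdeal K).comap (Finsupp.lmapDomain K K (p.graft i)) := fun _ hf =>
  (isOperadIdeal_operadIdeal {alpha K}).lmapDomain_graft_mem hf p hi hi'

/-- Grafting on the `i`-th leaf of `p`, as a linear map on the quotient operad. -/
def graftLeft (p : TernaryTree) (i : ℕ) (hi : 1 ≤ i) (hi' : i ≤ p.arity) :
    TPA K →ₗ[K] TPA K :=
  (tpaIdeal K).mapQ (tpaIdeal K) (Finsupp.lmapDomain K K (p.graft i))
    (tpaIdeal_le_comap_lmapDomain p hi hi')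

theorem graftLeft_mono (p : TernaryTree) (i : ℕ) (hi : 1 ≤ i) (hi' : i ≤ p.arity)
    (q : TernaryTree) : graftLeft p i hi hi' (TPA.mono K q) = TPA.mono K (p.graft i q) := by
  rw [graftLeft, TPA.mono, Submodule.mkQ_apply, Submodule.mapQ_apply, FreeTernary.mono,
    Finsupp.lmapDomain_apply, Finsupp.mapDomain_single]
  rfl

theorem exists_nodeLeft (b c : TernaryTree) :
    ∃ L : TPA K →ₗ[K] TPA K, ∀ p, L (TPA.mono K p) = TPA.mono K (node p b c) := by
  refine ⟨graftLeft (node leaf b c) 1 le_rfl (by simp only [arity]; omega), fun p => ?_⟩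
  simp [graftLeft_mono, graft, arity]

theorem exists_nodeMiddle (a c : TernaryTree) :
    ∃ L : TPA K →ₗ[K] TPA K, ∀ p, L (TPA.mono K p) = TPA.mono K (node a p c) := by
  refine ⟨graftLeft (node a leaf c) (a.arity + 1) (by omega) (by simp only [arity]; omega),
    fun p => ?_⟩
  simp [graftLeft_mono, graft, arity]

theorem exists_nodeRight (a b : TernaryTree) :
    ∃ L : TPA K →ₗ[K] TPA K, ∀ p, L (TPA.mono K p) = TPA.mono K (node a b p) := by
  refine ⟨graftLeft (node a b leaf) (a.arity + b.arity + 1) (by omega)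
    (by simp only [arity]; omega), fun p => ?_⟩
  rw [graftLeft_mono, graft, if_neg (by omega), if_neg (by omega), Nat.add_sub_cancel_left]
  simp [graft]

theorem node_left_add_eq_zero {p q r : TernaryTree}
    (h : TPA.mono K p + TPA.mono K q + TPA.mono K r = 0) (b c : TernaryTree) :
    TPA.mono K (node p b c) + TPA.mono K (node q b c) + TPA.mono K (node r b c) = 0 := by
  obtain ⟨L, hL⟩ := exists_nodeLeft (K := K) b c
  simpa [hL] using congrArg L h

theorem node_middle_add_eq_zero {p q r : TernaryTree} (a : TernaryTree)
    (h : TPA.mono K p + TPA.mono K q + TPA.mono K r = 0) (c : TernaryTree) :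
    TPA.mono K (node a p c) + TPA.mono K (node a q c) + TPA.mono K (node a r c) = 0 := by
  obtain ⟨L, hL⟩ := exists_nodeMiddle (K := K) a c
  simpa [hL] using congrArg L h

theorem node_right_add_eq_zero {p q r : TernaryTree} (a b : TernaryTree)
    (h : TPA.mono K p + TPA.mono K q + TPA.mono K r = 0) :
    TPA.mono K (node a b p) + TPA.mono K (node a b q) + TPA.mono K (node a b r) = 0 := by
  obtain ⟨L, hL⟩ := exists_nodeRight (K := K) a b
  simpa [hL] using congrArg L h

variable (K)

/-- Partial associativity, with arbitrary trees at the leaves. -/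
theorem mono_alpha (a b c d e : TernaryTree) :
    TPA.mono K (node (node a b c) d e) + TPA.mono K (node a (node b c d) e) +
      TPA.mono K (node a b (node c d e)) = 0 := by
  have h : TPA.mono K (t.graft 1 t) + TPA.mono K (t.graft 2 t) + TPA.mono K (t.graft 3 t) = 0 :=
    mono_add_eq_zero_iff.2 (subset_operadIdeal _ rfl)
  replace h := add_eq_zero_of_graft_right (p' := node (node leaf leaf leaf) leaf e)
    (q' := node leaf (node leaf leaf leaf) e) (r' := node leaf leaf (node leaf leaf e))
    h 5 e (by decide) (by decide) (by decide) (by decide)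
    (by simp [t, graft, arity]) (by simp [t, graft, arity]) (by simp [t, graft, arity])
  replace h := add_eq_zero_of_graft_right (p' := node (node leaf leaf leaf) d e)
    (q' := node leaf (node leaf leaf d) e) (r' := node leaf leaf (node leaf d e))
    h 4 d (by simp only [arity]) (by simp only [arity]; omega) (by decide)
    (by simp only [arity]; omega)
    (by simp [graft, arity]) (by simp [graft, arity]) (by simp [graft, arity])
  replace h := add_eq_zero_of_graft_right (p' := node (node leaf leaf c) d e)
    (q' := node leaf (node leaf c d) e) (r' := node leaf leaf (node c d e))
    h 3 c (by simp only [arity]; omega) (by simp only [arity]; omega) (by decide)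
    (by simp only [arity]; omega)
    (by simp [graft, arity]) (by simp [graft, arity]; omega) (by simp [graft, arity])
  replace h := add_eq_zero_of_graft_right (p' := node (node leaf b c) d e)
    (q' := node leaf (node b c d) e) (r' := node leaf b (node c d e))
    h 2 b (by simp only [arity]; omega) (by simp only [arity]; omega) (by decide)
    (by simp only [arity]; omega)
    (by simp [graft, arity]) (by simp [graft, arity]) (by simp [graft, arity])
  exact add_eq_zero_of_graft_right
    h 1 a (by simp only [arity]; omega) (by simp only [arity]; omega) (by decide)
    (by simp only [arity]; omega)
    (by simp [graft, arity]) (by simp [graft, arity]) (by simp [graft, arity])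

variable [CharZero K]

/-- The relation `β`: the sum of the eight consequences of `α` in weight `3`, with suitable signs,
is twice `β`. -/
theorem mono_beta (a b c d e f g : TernaryTree) :
    TPA.mono K (node a (node b c (node d e f)) g) + TPA.mono K (node a b (node c (node d e f) g)) +
      TPA.mono K (node a b (node c d (node e f g))) = 0 := by
  have h0 := mono_alpha K a b c (node d e f) g
  have h1 := node_left_add_eq_zero (mono_alpha K a b c d e) f g
  have h2 := mono_alpha K (node a b c) d e f g
  have h3 := mono_alpha K a b c d (node e f g)
  have h4 := mono_alpha K a (node b c d) e f g
  have h5 := mono_alpha K a b (node c d e) f g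
  have h6 := node_middle_add_eq_zero a (mono_alpha K b c d e f) g
  have h7 := node_right_add_eq_zero a b (mono_alpha K c d e f g)
  linear_combination (norm := module) (1/2 : K) • h0 + (1/2 : K) • h1 - (1/2 : K) • h2
    + (1/2 : K) • h3 - (1/2 : K) • h4 - (1/2 : K) • h5 + (1/2 : K) • h6 + (1/2 : K) • h7

/-- The relation `ν`, as a combination with denominator `3` of consequences of `α` and `β` in
weight `4`. -/
theorem mono_nu (a b c d e f g h k : TernaryTree) :
    TPA.mono K (node a b (node c d (node e f (node g h k)))) = 0 := by
  have h0 := node_left_add_eq_zero (mono_alpha K a b c (node d e f) g) h k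
  have h1 := mono_alpha K (node a b c) (node d e f) g h k
  have h2 := node_left_add_eq_zero (mono_beta K a b c d e f g) h k
  have h3 := node_middle_add_eq_zero (node a b c) (mono_alpha K d e f g h) k
  have h4 := mono_alpha K a b c (node d e f) (node g h k)
  have h5 := mono_alpha K a b (node c d (node e f g)) h k
  have h6 := mono_alpha K a b c (node d (node e f g) h) k
  have h7 := mono_beta K a b c d (node e f g) h k
  have h8 := node_middle_add_eq_zero a (mono_beta K b c d e f g h) k
  have h9 := mono_beta K a b c d e (node f g h) k
  have h10 := node_right_add_eq_zero a b (mono_alpha K c d (node e f g) h k)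
  have h11 := node_right_add_eq_zero a b (mono_beta K c d e f g h k)
  have h12 := mono_beta K a b c d e f (node g h k)
  have h13 := mono_alpha K a b c (node d e (node f g h)) k
  have h14 := node_right_add_eq_zero a b (node_right_add_eq_zero c d (mono_alpha K e f g h k))
  linear_combination (norm := module) -(1/3 : K) • h0 + (1/3 : K) • h1 + (1/3 : K) • h2
    - (1/3 : K) • h3 - (1/3 : K) • h4 - (1/3 : K) • h5 + (1/3 : K) • h6 - (2/3 : K) • h7
    + (1/3 : K) • h8 - (2/3 : K) • h9 + (1/3 : K) • h10 + (1/3 : K) • h11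
    + (1/3 : K) • h12
    + (1/3 : K) • h13 + (1/3 : K) • h14

theorem mono_eta (a b c d e f g h k : TernaryTree) :
    TPA.mono K (node a (node b c d) (node e (node f g h) k)) +
      TPA.mono K (node a (node b c d) (node e f (node g h k))) = 0 := by
  have h0 := mono_beta K a b c d e (node f g h) k
  have h1 := mono_beta K (node a b c) d e f g h k
  have h2 := mono_alpha K a b c (node d e (node f g h)) k
  have h3 := mono_alpha K a b c d (node e (node f g h) k)
  have h4 := mono_alpha K a b c d (node e f (node g h k))
  have h5 := mono_nu K a b c d e f g h k
  linear_combination (norm := module) -h0 - h1 + h2 + h3 + h4 - h5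

theorem mono_theta (a b c d e f g h k : TernaryTree) :
    TPA.mono K (node a b (node c (node d e f) (node g h k))) = 0 := by
  have h0 := mono_beta K a b c d e (node f g h) k
  have h1 := node_middle_add_eq_zero a (node_right_add_eq_zero b c (mono_alpha K d e f g h)) k
  have h2 := mono_beta K a b c (node d e f) g h k
  have h3 := mono_beta K a b c d (node e f g) h k
  have h4 := node_right_add_eq_zero a b (node_middle_add_eq_zero c (mono_alpha K d e f g h) k)
  have h5 := node_right_add_eq_zero a b (node_right_add_eq_zero c d (mono_alpha K e f g h k))
  have h6 := mono_nu K a b c d e f g h k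
  linear_combination (norm := module) h0 - h1 + h2 + h3 - h4 - h5 + h6

end TPA

/-! ### Reduction to irreducible trees -/

namespace TPA
open FreeTernary NormalForm
variable (K : Type*) [Field K]

/-- The span of the classes of the trees that are smaller than `p` and of the same arity. -/
def lower (p : TernaryTree) : Submodule K (TPA K) :=
  Submodule.span K (TPA.mono K '' {q | q.arity = p.arity ∧ PathLex q p})

variable {K}

theorem mono_mem_lower {p q : TernaryTree} (ha : q.arity = p.arity) (h : PathLex q p) :
    TPA.mono K q ∈ lower K p := Submodule.subset_span ⟨q, ⟨ha, h⟩, rfl⟩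

theorem mem_lower_of_linearMap {p : TernaryTree} (L : TPA K →ₗ[K] TPA K)
    (F : TernaryTree → TernaryTree) (hL : ∀ q, L (TPA.mono K q) = TPA.mono K (F q))
    (hF : ∀ q, q.arity = p.arity → PathLex q p →
      (F q).arity = (F p).arity ∧ PathLex (F q) (F p))
    (h : TPA.mono K p ∈ lower K p) : TPA.mono K (F p) ∈ lower K (F p) := by
  rw [← hL]
  refine (Submodule.map_span_le L _ _).2 ?_ (Submodule.mem_map_of_mem h)
  rintro _ ⟨q, ⟨ha, hq⟩, rfl⟩
  rw [hL]
  exact mono_mem_lower (hF q ha hq).1 (hF q ha hq).2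

/-- One step of the reduction: rewriting an occurrence of a leading monomial gives smaller trees. -/
theorem mono_mem_lower_of_reducible [CharZero K] {p : TernaryTree} (h : Reducible p) :
    TPA.mono K p ∈ lower K p := by
  induction h with
  | @left a b c h ih =>
    obtain ⟨L, hL⟩ := exists_nodeLeft (K := K) b c
    exact mem_lower_of_linearMap L (node · b c) hL
      (fun q ha hq => ⟨by simp only [arity, ha], hq.node_left ha b c⟩) ih
  | @middle b a c h ih =>
    obtain ⟨L, hL⟩ := exists_nodeMiddle (K := K) a c
    exact mem_lower_of_linearMap L (node a · c) hL
      (fun q ha hq => ⟨by simp only [arity, ha], hq.node_middle a ha c⟩) ih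
  | @right c a b h ih =>
    obtain ⟨L, hL⟩ := exists_nodeRight (K := K) a b
    exact mem_lower_of_linearMap L (node a b ·) hL
      (fun q ha hq => ⟨by simp only [arity, ha], hq.node_right a b ha⟩) ih
  | alpha a b c d e =>
    rw [show TPA.mono K (node (node a b c) d e) = -TPA.mono K (node a (node b c d) e) -
      TPA.mono K (node a b (node c d e)) by
        linear_combination (norm := module) mono_alpha K a b c d e]
    refine sub_mem (neg_mem (mono_mem_lower ?_ ?_)) (mono_mem_lower ?_ ?_)
    · simp only [arity]; omega
    · simp only [PathLex, path_node, pathFrom, List.append_assoc]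
      exact pathFrom_append_lt 1 a _ _
    · simp only [arity]; omega
    · simp only [PathLex, path_node, pathFrom, List.append_assoc]
      exact pathFrom_append_lt 1 a _ _
  | beta a b c d e f g =>
    rw [show TPA.mono K (node a (node b c (node d e f)) g) =
      -TPA.mono K (node a b (node c (node d e f) g)) -
      TPA.mono K (node a b (node c d (node e f g))) by
        linear_combination (norm := module) mono_beta K a b c d e f g]
    refine sub_mem (neg_mem (mono_mem_lower ?_ ?_)) (mono_mem_lower ?_ ?_)
    · simp only [arity]; omega
    · simp only [PathLex, path_node, pathFrom, List.append_assoc]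
      exact List.append_left_lt (pathFrom_append_lt 1 b _ _)
    · simp only [arity]; omega
    · simp only [PathLex, path_node, pathFrom, List.append_assoc]
      exact List.append_left_lt (pathFrom_append_lt 1 b _ _)
  | eta a b c d e f g h k =>
    rw [eq_neg_of_add_eq_zero_left (mono_eta K a b c d e f g h k)]
    refine neg_mem (mono_mem_lower ?_ ?_)
    · simp only [arity]; omega
    · simp only [PathLex, path_node, pathFrom, List.append_assoc]
      -- The path sequences agree on `a, …, e`; then `f` has depth `2` and `3`, respectively.
      iterate 5 refine List.append_left_lt ?_
      exact pathFrom_append_lt 2 f _ _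
  | theta a b c d e f g h k => rw [mono_theta]; exact zero_mem _
  | nu a b c d e f g h k => rw [mono_nu]; exact zero_mem _

theorem mono_mem_span_normal [CharZero K] (p : TernaryTree) :
    TPA.mono K p ∈ Submodule.span K
      (TPA.mono K '' {q | ¬ Reducible q ∧ q.arity = p.arity ∧ q.path ≤ p.path}) := by
  induction p using pathLex_induction with
  | h p ih =>
  by_cases hp : Reducible p
  · refine Submodule.span_le.2 ?_ (mono_mem_lower_of_reducible hp)
    rintro _ ⟨q, ⟨ha, hq⟩, rfl⟩
    refine Submodule.span_mono (Set.image_mono ?_) (ih q ha hq)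
    exact fun r ⟨hr, hr', hr''⟩ => ⟨hr, hr'.trans ha, hr''.trans (le_of_lt hq)⟩
  · exact Submodule.subset_span ⟨p, ⟨hp, rfl, le_rfl⟩, rfl⟩

open Classical in
/-- Evaluation at the generator factors through the quotient and maps the irreducible trees to basis
vectors. -/
theorem linearIndependent_mono_tree : LinearIndependent K fun i => TPA.mono K (tree i) := by
  let x : ℕ → NormalForm → K := fun _ => Pi.single (m 0) 1
  have hker : tpaIdeal K ≤ LinearMap.ker (Finsupp.linearCombination K fun p => eval p x) := by
    intro f hf
    replace hf := mem_identities.1 (operadIdeal_le isOperadIdeal_identities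
      (Set.singleton_subset_iff.2 alpha_mem_identities) hf)
    rw [LinearMap.mem_ker, Finsupp.linearCombination_apply, Finsupp.sum,
      ← Finset.sum_fiberwise_of_maps_to fun p hp => Finset.mem_image_of_mem arity hp]
    refine Finset.sum_eq_zero fun n _ => ?_
    rw [← hf n x, Finsupp.sum, Finset.sum_filter]
    exact Finset.sum_congr rfl fun p _ => by split_ifs <;> simp
  refine LinearIndependent.of_comp ((tpaIdeal K).liftQ _ hker) ?_
  have : ⇑((tpaIdeal K).liftQ _ hker) ∘ (fun i => TPA.mono K (tree i)) =
      fun i => Pi.single i (1 : K) := by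
    funext i
    rw [← eval_tree (K := K) i]
    simp [TPA.mono, FreeTernary.mono, x]
  rw [this]
  exact Pi.linearIndependent_single_one _ _

theorem component_eq_span [CharZero K] (n : ℕ) : TPA.component K n =
    Submodule.span K (TPA.mono K '' {p | p.arity = n ∧ ¬ Reducible p}) := by
  apply le_antisymm
  · rw [TPA.component, FreeTernary.component, Finsupp.supported_eq_span_single,
      Submodule.map_span_le]
    rintro _ ⟨p, hp, rfl⟩
    refine Submodule.span_mono (Set.image_mono ?_) (mono_mem_span_normal p)
    exact fun q ⟨hq, ha, _⟩ => ⟨ha.trans hp, hq⟩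
  · rw [Submodule.span_le]
    rintro _ ⟨p, ⟨hp, _⟩, rfl⟩
    exact Submodule.mem_map_of_mem (mono_mem_component hp)

theorem linearIndependent_of_range {ι : Type*} {φ : ι → TernaryTree} {n : ℕ}
    (hφ : Function.Injective φ) (hr : Set.range φ = {p | p.arity = n ∧ ¬ Reducible p}) :
    LinearIndependent K fun i => TPA.mono K (φ i) := by
  have h (i : ι) : ∃ j, tree j = φ i :=
    not_reducible_iff.1 (hr.le ⟨i, rfl⟩).2
  choose ψ hψ using h
  have := (linearIndependent_mono_tree (K := K)).comp ψ fun i j hij =>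
    hφ (by rw [← hψ, ← hψ, hij])
  simpa [Function.comp_def, hψ] using this

theorem span_of_range [CharZero K] {ι : Type*} {φ : ι → TernaryTree} {n : ℕ}
    (hr : Set.range φ = {p | p.arity = n ∧ ¬ Reducible p}) :
    Submodule.span K (Set.range fun i => TPA.mono K (φ i)) = TPA.component K n := by
  rw [component_eq_span, ← hr, Set.range_comp' (TPA.mono K)]

theorem finrank_of_range [CharZero K] {ι : Type*} [Fintype ι] {φ : ι → TernaryTree} {n : ℕ}
    (hφ : Function.Injective φ) (hr : Set.range φ = {p | p.arity = n ∧ ¬ Reducible p}) :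
    Module.finrank K (TPA.component K n) = Fintype.card ι := by
  rw [← span_of_range hr, finrank_span_eq_card (linearIndependent_of_range hφ hr)]

theorem finrank_one [CharZero K] : Module.finrank K (TPA.component K 1) = 1 := by
  refine finrank_of_range (φ := fun _ : Fin 1 => tree (m 0))
    (fun _ _ _ => Subsingleton.elim _ _) ?_
  ext p
  simp only [Set.mem_range, Set.mem_ofPred_eq, not_reducible_iff]
  constructor
  · rintro ⟨_, rfl⟩
    exact ⟨rfl, _, rfl⟩
  · rintro ⟨h, i, rfl⟩
    rw [arity_tree] at h
    rcases i with (_ | k) | k | l | ⟨j, l⟩ <;> simp only at h <;>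
      first | omega | exact ⟨0, rfl⟩

theorem finrank_three [CharZero K] : Module.finrank K (TPA.component K 3) = 1 := by
  refine finrank_of_range (φ := fun _ : Fin 1 => tree (m 1))
    (fun _ _ _ => Subsingleton.elim _ _) ?_
  ext p
  simp only [Set.mem_range, Set.mem_ofPred_eq, not_reducible_iff]
  constructor
  · rintro ⟨_, rfl⟩
    exact ⟨rfl, _, rfl⟩
  · rintro ⟨h, i, rfl⟩
    rw [arity_tree] at h
    rcases i with (_ | _ | k) | k | l | ⟨j, l⟩ <;> simp only at h <;>
      first | omega | exact ⟨0, rfl⟩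

theorem finrank_five [CharZero K] : Module.finrank K (TPA.component K 5) = 2 := by
  have h := finrank_of_range (K := K) (φ := fun i : Bool => tree (cond i (m 2) (r 0)))
    (n := 5) ?_ ?_
  · rw [h, Fintype.card_bool]
  · refine tree_injective.comp ?_
    rintro (_ | _) (_ | _) h <;> simp at h ⊢
  ext p
  simp only [Set.mem_range, Set.mem_ofPred_eq, not_reducible_iff]
  constructor
  · rintro ⟨_ | _, rfl⟩
    · exact ⟨rfl, _, rfl⟩
    · exact ⟨rfl, _, rfl⟩
  · rintro ⟨h, i, rfl⟩
    rw [arity_tree] at h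
    rcases i with (_ | _ | _ | k) | (_ | k) | l | ⟨j, l⟩ <;> simp only at h <;>
      first | omega | exact ⟨true, rfl⟩ | exact ⟨false, rfl⟩

end TPA

/-! ### The Gröbner basis -/

namespace FreeTernary
open NormalForm
variable {K : Type*} [Field K]

/-- An irreducible leading monomial of an element of the ideal would be congruent to a combination
of smaller irreducible trees. -/
theorem IsLeadingMonomial.reducible [CharZero K] {f : FreeTernary K} (hf : f ∈ tpaIdeal K)
    {q : TernaryTree} (hq : IsLeadingMonomial f q) : Reducible q := by
  classical
  by_contra hn
  obtain ⟨i, rfl⟩ := not_reducible_iff.1 hn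
  refine (TPA.linearIndependent_mono_tree (K := K)).notMem_span_image
    (s := {j | PathLex (tree j) (tree i)}) (x := i) (lt_irrefl (tree i).path) ?_
  have hsum : ∑ p ∈ f.support, f p • TPA.mono K p = 0 := by
    rw [← (Submodule.Quotient.mk_eq_zero _).2 hf, ← Submodule.mkQ_apply]
    conv_rhs => rw [← f.sum_single, Finsupp.sum, map_sum]
    refine Finset.sum_congr rfl fun p _ => ?_
    rw [TPA.mono, ← map_smul, mono, Finsupp.smul_single, smul_eq_mul, mul_one]
  rw [← Finset.add_sum_erase _ _ hq.1] at hsum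
  rw [← Submodule.smul_mem_iff _ (Finsupp.mem_support_iff.1 hq.1),
    eq_neg_of_add_eq_zero_left hsum]
  refine neg_mem (Submodule.sum_mem _ fun p hp => Submodule.smul_mem _ _ ?_)
  have hlt := hq.2 p (Finset.mem_of_mem_erase hp) (Finset.ne_of_mem_erase hp)
  refine Submodule.span_le.2 ?_ (TPA.mono_mem_span_normal p)
  rintro _ ⟨r, ⟨hr, -, hle⟩, rfl⟩
  obtain ⟨j, rfl⟩ := not_reducible_iff.1 hr
  exact Submodule.subset_span ⟨j, lt_of_le_of_lt hle hlt, rfl⟩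

theorem exists_isLeadingMonomial {f : FreeTernary K} (hf : f ≠ 0) :
    ∃ q, IsLeadingMonomial f q := by
  obtain ⟨q, hq, hmax⟩ := f.support.exists_max_image path (Finsupp.support_nonempty_iff.2 hf)
  exact ⟨q, hq, fun p hp hne => lt_of_le_of_ne (hmax p hp) fun h => hne (path_injective h)⟩

theorem IsLeadingMonomial.unique {f : FreeTernary K} {p q : TernaryTree}
    (hp : IsLeadingMonomial f p) (hq : IsLeadingMonomial f q) : p = q := by
  by_contra h
  exact lt_asymm (hp.2 q hq.1 (Ne.symm h)) (hq.2 p hp.1 h)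

theorem isLeadingMonomial_mono (p : TernaryTree) : IsLeadingMonomial (mono K p) p := by
  classical
  simp [IsLeadingMonomial, mono]

theorem IsLeadingMonomial.add_mono {f : FreeTernary K} {p q : TernaryTree}
    (hf : IsLeadingMonomial f p) (h : PathLex q p) : IsLeadingMonomial (f + mono K q) p := by
  classical
  have hne : p ≠ q := by rintro rfl; exact lt_irrefl _ h
  refine ⟨?_, fun r hr hrp => ?_⟩
  · rw [Finsupp.mem_support_iff, Finsupp.add_apply, mono, Finsupp.single_eq_of_ne hne, add_zero]
    exact Finsupp.mem_support_iff.1 hf.1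
  · rcases Finset.mem_union.1 (Finsupp.support_add hr) with hr | hr
    · exact hf.2 r hr hrp
    · rw [Finset.mem_singleton.1 (Finsupp.support_single_subset hr)]
      exact h

instance (p q : TernaryTree) : Decidable (PathLex p q) :=
  inferInstanceAs (Decidable (p.path < q.path))

theorem isLeadingMonomial_alpha : IsLeadingMonomial (alpha K) (t.graft 1 t) :=
  ((isLeadingMonomial_mono _).add_mono (by decide)).add_mono (by decide)

theorem isLeadingMonomial_beta : IsLeadingMonomial (beta K) (t.graft 2 (t.graft 3 t)) :=
  ((isLeadingMonomial_mono _).add_mono (by decide)).add_mono (by decide)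

theorem isLeadingMonomial_eta :
    IsLeadingMonomial (eta K) ((t.graft 2 t).graft 5 (t.graft 2 t)) :=
  (isLeadingMonomial_mono _).add_mono (by decide)

theorem mem_leadingTrees_iff {p : TernaryTree} :
    p ∈ leadingTrees ↔ ∃ g ∈ groebner K, IsLeadingMonomial g p := by
  constructor
  · rintro (rfl | rfl | rfl | rfl | rfl)
    · exact ⟨_, .inl rfl, isLeadingMonomial_alpha⟩
    · exact ⟨_, .inr (.inl rfl), isLeadingMonomial_beta⟩
    · exact ⟨_, .inr (.inr (.inl rfl)), isLeadingMonomial_eta⟩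
    · exact ⟨_, .inr (.inr (.inr (.inl rfl))), isLeadingMonomial_mono _⟩
    · exact ⟨_, .inr (.inr (.inr (.inr rfl))), isLeadingMonomial_mono _⟩
  · rintro ⟨g, rfl | rfl | rfl | rfl | rfl, h⟩
    · exact .inl (h.unique isLeadingMonomial_alpha)
    · exact .inr (.inl (h.unique isLeadingMonomial_beta))
    · exact .inr (.inr (.inl (h.unique isLeadingMonomial_eta)))
    · exact .inr (.inr (.inr (.inl (h.unique (isLeadingMonomial_mono _)))))
    · exact .inr (.inr (.inr (.inr (h.unique (isLeadingMonomial_mono _)))))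

theorem IsLeadingMonomial.ne_zero {f : FreeTernary K} {p : TernaryTree}
    (h : IsLeadingMonomial f p) : f ≠ 0 :=
  Finsupp.support_nonempty_iff.1 ⟨p, h.1⟩

theorem groebner_subset [CharZero K] : groebner K ⊆ tpaIdeal K := by
  rintro g (rfl | rfl | rfl | rfl | rfl)
  · exact subset_operadIdeal _ rfl
  · refine TPA.mono_add_eq_zero_iff.1 ?_
    simpa [t, graft, arity] using
      TPA.mono_beta K leaf leaf leaf leaf leaf leaf leaf
  · rw [eta, SetLike.mem_coe, ← Submodule.Quotient.mk_eq_zero, ← Submodule.mkQ_apply, map_add]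
    simpa [t, graft, arity, TPA.mono] using
      TPA.mono_eta K leaf leaf leaf leaf leaf leaf leaf leaf leaf
  · rw [theta, SetLike.mem_coe, ← Submodule.Quotient.mk_eq_zero, ← Submodule.mkQ_apply]
    simpa [t, graft, arity, TPA.mono] using
      TPA.mono_theta K leaf leaf leaf leaf leaf leaf leaf leaf leaf
  · rw [nu, SetLike.mem_coe, ← Submodule.Quotient.mk_eq_zero, ← Submodule.mkQ_apply]
    simpa [t, graft, arity, TPA.mono] using
      TPA.mono_nu K leaf leaf leaf leaf leaf leaf leaf leaf leaf

theorem isGroebnerBasis_groebner [CharZero K] : IsGroebnerBasis (groebner K) (tpaIdeal K) where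
  finite := by simp [groebner]
  relation := by
    rintro g (rfl | rfl | rfl | rfl | rfl)
    · exact ⟨isLeadingMonomial_alpha.ne_zero, 5,
        add_mem (add_mem (mono_mem_component (by decide)) (mono_mem_component (by decide)))
          (mono_mem_component (by decide))⟩
    · exact ⟨isLeadingMonomial_beta.ne_zero, 7,
        add_mem (add_mem (mono_mem_component (by decide)) (mono_mem_component (by decide)))
          (mono_mem_component (by decide))⟩
    · exact ⟨isLeadingMonomial_eta.ne_zero, 9,
        add_mem (mono_mem_component (by decide)) (mono_mem_component (by decide))⟩
    · exact ⟨(isLeadingMonomial_mono _).ne_zero, 9, mono_mem_component (by decide)⟩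
    · exact ⟨(isLeadingMonomial_mono _).ne_zero, 9, mono_mem_component (by decide)⟩
  generates := le_antisymm (operadIdeal_le (isOperadIdeal_operadIdeal _) groebner_subset)
    (operadIdeal_le (isOperadIdeal_operadIdeal _)
      (Set.singleton_subset_iff.2 (subset_operadIdeal _ (.inl rfl))))
  divides := by
    intro n f hf _ hne
    obtain ⟨q, hq⟩ := exists_isLeadingMonomial hne
    obtain ⟨p, hp, hd⟩ := (hq.reducible hf).exists_divides
    obtain ⟨g, hg, hgp⟩ := (mem_leadingTrees_iff (K := K)).1 hp
    exact ⟨g, hg, p, q, hgp, hq, hd⟩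

theorem not_divides_iff {p : TernaryTree} :
    (∀ g ∈ groebner K, ∀ q, IsLeadingMonomial g q → ¬ Divides q p) ↔ ¬ Reducible p := by
  constructor
  · intro h hp
    obtain ⟨q, hq, hd⟩ := hp.exists_divides
    obtain ⟨g, hg, hgq⟩ := (mem_leadingTrees_iff (K := K)).1 hq
    exact h g hg q hgq hd
  · exact fun hp g hg q hgq hd =>
      hp (hd.reducible (reducible_of_mem_leadingTrees (mem_leadingTrees_iff.2 ⟨g, hg, hgq⟩)))

end FreeTernary

end

theorem theorem3p9 (K : Type*) [Field K] [CharZero K] :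
    -- the dimensions in arities 1, 3, 5, 7
    (Module.finrank K (TPA.component K 1) = 1 ∧
      Module.finrank K (TPA.component K 3) = 1 ∧
      Module.finrank K (TPA.component K 5) = 2 ∧
      Module.finrank K (TPA.component K 7) = 4) ∧
    -- the Gröbner basis
    FreeTernary.IsGroebnerBasis (FreeTernary.groebner K) (FreeTernary.tpaIdeal K) ∧
    ∀ k : ℕ, 3 ≤ k →
      -- the dimension formula
      Module.finrank K (TPA.component K (2 * k + 1)) = k + 1 ∧
      -- the classes of the trees `f₁, …, f_{k+1}` form a basis
      LinearIndependent K
        (fun i : Fin (k + 1) => TPA.mono K (TernaryTree.normalTree k (i + 1))) ∧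
      Submodule.span K
        (Set.range fun i : Fin (k + 1) => TPA.mono K (TernaryTree.normalTree k (i + 1))) =
          TPA.component K (2 * k + 1) ∧
      -- they are the trees not divisible by a leading monomial of the Gröbner basis
      {p : TernaryTree | p.arity = 2 * k + 1 ∧
          ∀ g ∈ FreeTernary.groebner K, ∀ q : TernaryTree,
            FreeTernary.IsLeadingMonomial g q → ¬ TernaryTree.Divides q p} =
        Set.range (fun i : Fin (k + 1) => TernaryTree.normalTree k (i + 1)) := by
  have hr {k : ℕ} (hk : 3 ≤ k) := NormalForm.range_normalTree hk
  have hi {k : ℕ} (hk : 3 ≤ k) := NormalForm.normalTree_injective hk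
  have hdim {k : ℕ} (hk : 3 ≤ k) : Module.finrank K (TPA.component K (2 * k + 1)) = k + 1 := by
    rw [TPA.finrank_of_range (hi hk) (hr hk), Fintype.card_fin]
  have hseven : Module.finrank K (TPA.component K 7) = 4 := hdim (k := 3) le_rfl
  refine ⟨⟨TPA.finrank_one, TPA.finrank_three, TPA.finrank_five, hseven⟩,
    FreeTernary.isGroebnerBasis_groebner, fun k hk => ⟨hdim hk,
      TPA.linearIndependent_of_range (hi hk) (hr hk), TPA.span_of_range (hr hk), ?_⟩⟩
  simp only [FreeTernary.not_divides_iff, hr hk]
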